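/- Let $L$ be a finite-dimensional Lie algebra over a field $\Omega$ (of arbitrary characteristic). Let $L\wedge L$ be the Lie algebra over $\Omega$ generated by the symbols $m\wedge n$ ($m,n\in L$) subject to the relations, for all $\alpha\in\Omega$ and $m,m',n,n'\in L$: $\alpha(m\wedge n)=\alpha m\wedge n=m\wedge\alpha n$; $(m+m')\wedge n=m\wedge n+m'\wedge n$; $m\wedge(n+n')=m\wedge n+m\wedge n'$; $[m,m']\wedge n=m\wedge[m',n]-m'\wedge[m,n]$; $m\wedge[n,n']=[n',m]\wedge n-[n,m]\wedge n'$; $[m\wedge n,\,m'\wedge n']=-[n,m]\wedge[m',n']$; $m\wedge m=0$. Let $\mathcal M(L)$ be the kernel of the Lie algebra homomorphism $L\wedge L\to[L,L]$ with $m\wedge n\mapsto[m,n]$, let $\mathcal M_0(L)\subseteq\mathcal M(L)$ be the linear span of the elements $m\wedge n$ with $m,n\in L$ and $[m,n]=0$ (an ideal of $L\wedge L$), and let $B(L)=\mathcal M(L)/\mathcal M_0(L)$ be the Bogomolov multiplier of $L$. Let $Z^2(L,\Omega)$ be the space of alternating bilinear maps $f:L\times L\to\Omega$ with $f([x_1,x_2],x_3)+f([x_2,x_3],x_1)+f([x_3,x_1],x_2)=0$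 for all $x_1,x_2,x_3\in L$, let $B^2(L,\Omega)$ be its subspace of the maps $(x_1,x_2)\mapsto-\sigma([x_1,x_2])$ with $\sigma:L\to\Omega$ linear, and let $H^2(L,\Omega)=Z^2(L,\Omega)/B^2(L,\Omega)$, regarded as an abelian Lie algebra. Let $$B_0(L)=\{\overline f\in H^2(L,\Omega)\ :\ f(x_1,x_2)=0\text{ whenever }x_1,x_2\in L\text{ and }[x_1,x_2]=0\}.$$ Then $B(L)$ and $B_0(L)$ are isomorphic as Lie algebras over $\Omega$. -/

import Mathlib

set_option maxSynthPendingDepth 3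

namespace BogomolovLie

noncomputable section

section Exterior

variable (Ω : Type*) [Field Ω] (L : Type*) [LieRing L] [LieAlgebra Ω L]

/-- The formal symbol `m ∧ n`, as a generator of the free Lie algebra on `L × L`. -/
abbrev sym {L : Type*} (m n : L) : FreeLieAlgebra Ω (L × L) := FreeLieAlgebra.of Ω (m, n)

/-- The defining relations of the exterior square of a Lie algebra. -/
inductive ExteriorRel : FreeLieAlgebra Ω (L × L) → FreeLieAlgebra Ω (L × L) → Prop
  | smul_left (α : Ω) (m n : L) : ExteriorRel (α • sym Ω m n) (sym Ω (α • m) n)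
  | smul_right (α : Ω) (m n : L) : ExteriorRel (α • sym Ω m n) (sym Ω m (α • n))
  | add_left (m m' n : L) : ExteriorRel (sym Ω (m + m') n) (sym Ω m n + sym Ω m' n)
  | add_right (m n n' : L) : ExteriorRel (sym Ω m (n + n')) (sym Ω m n + sym Ω m n')
  | lie_left (m m' n : L) :
      ExteriorRel (sym Ω ⁅m, m'⁆ n) (sym Ω m ⁅m', n⁆ - sym Ω m' ⁅m, n⁆)
  | lie_right (m n n' : L) :
      ExteriorRel (sym Ω m ⁅n, n'⁆) (sym Ω ⁅n', m⁆ n - sym Ω ⁅n, m⁆ n')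
  | lie_sym (m n m' n' : L) :
      ExteriorRel ⁅sym Ω m n, sym Ω m' n'⁆ (-sym Ω ⁅n, m⁆ ⁅m', n'⁆)
  | self (m : L) : ExteriorRel (sym Ω m m) 0

/-- The Lie ideal of the free Lie algebra on `L × L` generated by the defining relations. -/
def exteriorIdeal : LieIdeal Ω (FreeLieAlgebra Ω (L × L)) :=
  LieSubmodule.lieSpan Ω (FreeLieAlgebra Ω (L × L)) {x | ∃ a b, ExteriorRel Ω L a b ∧ x = a - b}

/-- The exterior square `L ∧ L`: the Lie algebra generated by the symbols `m ∧ n`, subject to the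
defining relations. -/
abbrev ExteriorSquare : Type _ := FreeLieAlgebra Ω (L × L) ⧸ exteriorIdeal Ω L

variable {L}

/-- The element `m ∧ n` of the exterior square. -/
def wedge (m n : L) : ExteriorSquare Ω L := LieSubmodule.Quotient.mk (sym Ω m n)

variable (L)

/-- The map `(m, n) ↦ [m, n]` on the free Lie algebra, with values in the derived algebra
`[L, L]`. -/
def freeCommutator :
    FreeLieAlgebra Ω (L × L) →ₗ⁅Ω⁆ ↥(⁅(⊤ : LieIdeal Ω L), (⊤ : LieIdeal Ω L)⁆ : LieIdeal Ω L) :=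
  FreeLieAlgebra.lift Ω fun p =>
    ⟨⁅p.1, p.2⁆, LieSubmodule.lie_mem_lie (LieSubmodule.mem_top p.1) (LieSubmodule.mem_top p.2)⟩

variable {L}

theorem coe_freeCommutator_sym (m n : L) :
    (freeCommutator Ω L (sym Ω m n) : L) = ⁅m, n⁆ := by
  simp [freeCommutator, sym]

variable (L)

theorem freeCommutator_rel {a b : FreeLieAlgebra Ω (L × L)} (h : ExteriorRel Ω L a b) :
    freeCommutator Ω L a = freeCommutator Ω L b := by
  apply Subtype.ext
  cases h with
  | smul_left α m n => simp [coe_freeCommutator_sym]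
  | smul_right α m n => simp [coe_freeCommutator_sym]
  | add_left m m' n => simp [coe_freeCommutator_sym]
  | add_right m n n' => simp [coe_freeCommutator_sym]
  | lie_left m m' n => simp [coe_freeCommutator_sym]
  | lie_right m n n' =>
    simp only [map_sub, LieSubmodule.coe_sub, coe_freeCommutator_sym]
    rw [← lie_skew n' m, ← lie_skew n m, leibniz_lie m n n', neg_lie, neg_lie,
      ← lie_skew ⁅m, n'⁆ n]
    abel
  | lie_sym m n m' n' =>
    simp only [LieHom.map_lie, map_neg, NegMemClass.coe_neg, coe_freeCommutator_sym,
      LieIdeal.coe_bracket_of_module]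
    rw [← lie_skew m n]
    simp [coe_freeCommutator_sym]
  | self m => simp [coe_freeCommutator_sym]

theorem exteriorIdeal_le_ker : exteriorIdeal Ω L ≤ (freeCommutator Ω L).ker := by
  refine LieSubmodule.lieSpan_le.mpr ?_
  rintro x ⟨a, b, h, rfl⟩
  simp [LieHom.mem_ker, map_sub, freeCommutator_rel Ω L h]

/-- The homomorphism of Lie algebras `L ∧ L → [L, L]` induced by `(m, n) ↦ [m, n]`. -/
def commutatorMap :
    ExteriorSquare Ω L →ₗ⁅Ω⁆ ↥(⁅(⊤ : LieIdeal Ω L), (⊤ : LieIdeal Ω L)⁆ : LieIdeal Ω L) :=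
  { Submodule.liftQ (exteriorIdeal Ω L).toSubmodule (freeCommutator Ω L).toLinearMap
      (fun _ hx => LieHom.mem_ker.mp (exteriorIdeal_le_ker Ω L hx)) with
    map_lie' := by
      intro x y
      induction x using Submodule.Quotient.induction_on
      induction y using Submodule.Quotient.induction_on
      exact (freeCommutator Ω L).map_lie _ _ }

variable {L}

theorem coe_commutatorMap_wedge (m n : L) :
    (commutatorMap Ω L (wedge Ω m n) : L) = ⁅m, n⁆ :=
  coe_freeCommutator_sym Ω m n

theorem mk_eq_of_rel {a b : FreeLieAlgebra Ω (L × L)} (h : ExteriorRel Ω L a b) :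
    (LieSubmodule.Quotient.mk a : ExteriorSquare Ω L) = LieSubmodule.Quotient.mk b :=
  (Submodule.Quotient.eq _).mpr (LieSubmodule.subset_lieSpan ⟨a, b, h, rfl⟩)

theorem lie_wedge_eq_zero (w : ExteriorSquare Ω L) {m n : L} (h : ⁅m, n⁆ = 0) :
    ⁅w, wedge Ω m n⁆ = 0 := by
  have hz (x : L) : wedge Ω x (0 : L) = 0 := by
    simpa [wedge] using (mk_eq_of_rel Ω (ExteriorRel.smul_right (0 : Ω) x (0 : L))).symm
  induction w using Submodule.Quotient.induction_on with
  | _ w =>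
  let S : LieSubalgebra Ω (FreeLieAlgebra Ω (L × L)) :=
    { carrier := {x | ⁅(LieSubmodule.Quotient.mk x : ExteriorSquare Ω L), wedge Ω m n⁆ = 0}
      add_mem' := by
        intro a b ha hb
        change ⁅(LieSubmodule.Quotient.mk a + LieSubmodule.Quotient.mk b : ExteriorSquare Ω L),
          wedge Ω m n⁆ = 0
        rw [add_lie, ha, hb, add_zero]
      zero_mem' := zero_lie (wedge Ω m n)
      smul_mem' := by
        intro c a ha
        change ⁅(c • LieSubmodule.Quotient.mk a : ExteriorSquare Ω L), wedge Ω m n⁆ = 0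
        rw [smul_lie, ha, smul_zero]
      lie_mem' := by
        intro a b ha hb
        change ⁅⁅(LieSubmodule.Quotient.mk a : ExteriorSquare Ω L), LieSubmodule.Quotient.mk b⁆,
          wedge Ω m n⁆ = 0
        rw [lie_lie, ha, hb, lie_zero, lie_zero, sub_zero] }
  have hS (p : L × L) : FreeLieAlgebra.of Ω p ∈ S := by
    have h1 := mk_eq_of_rel Ω (ExteriorRel.lie_sym (Ω := Ω) p.1 p.2 m n)
    have h2 := hz ⁅p.2, p.1⁆
    rw [h] at h1
    change LieSubmodule.Quotient.mk ⁅sym Ω p.1 p.2, sym Ω m n⁆ = (0 : ExteriorSquare Ω L)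
    rw [h1]
    change -wedge Ω ⁅p.2, p.1⁆ (0 : L) = 0
    rw [h2, neg_zero]
  have hid : S.incl.comp (FreeLieAlgebra.lift Ω fun p => (⟨FreeLieAlgebra.of Ω p, hS p⟩ : S)) =
      LieHom.id := by
    apply FreeLieAlgebra.hom_ext
    intro p
    simp
  have hw := LieHom.congr_fun hid w
  have hw' : S.incl.comp (FreeLieAlgebra.lift Ω fun p => (⟨FreeLieAlgebra.of Ω p, hS p⟩ : S)) w ∈ S :=
    (FreeLieAlgebra.lift Ω (fun p => (⟨FreeLieAlgebra.of Ω p, hS p⟩ : S)) w).2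
  rw [hw] at hw'
  exact hw'

variable (L)

/-- `M(L)`, the kernel of `L ∧ L → [L, L]`. -/
def schurKernel : LieIdeal Ω (ExteriorSquare Ω L) := (commutatorMap Ω L).ker

/-- `M₀(L)`, the linear span of the elements `m ∧ n` with `[m, n] = 0`; it is central in `L ∧ L`, so
it is an ideal. -/
def commutingWedges : LieIdeal Ω (ExteriorSquare Ω L) where
  toSubmodule := Submodule.span Ω {w | ∃ m n : L, ⁅m, n⁆ = 0 ∧ w = wedge Ω m n}
  lie_mem := by
    intro x y hy
    have h0 : ⁅x, y⁆ = 0 := by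
      induction hy using Submodule.span_induction with
      | mem y h =>
        obtain ⟨m, n, h, rfl⟩ := h
        exact lie_wedge_eq_zero Ω x h
      | zero => exact lie_zero x
      | add a b _ _ ha hb => rw [lie_add, ha, hb, add_zero]
      | smul c a _ ha => rw [lie_smul, ha, smul_zero]
    rw [h0]
    exact Submodule.zero_mem _

theorem commutingWedges_le_schurKernel : commutingWedges Ω L ≤ schurKernel Ω L := by
  intro x hx
  refine Submodule.span_le (p := (schurKernel Ω L).toSubmodule).mpr ?_ hx
  rintro _ ⟨m, n, h, rfl⟩
  change commutatorMap Ω L (wedge Ω m n) = 0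
  exact Subtype.ext ((coe_commutatorMap_wedge Ω m n).trans h)

/-- The Bogomolov multiplier `B(L) = M(L) / M₀(L)`. Here `M₀(L) ≤ M(L)`, so that the preimage of
`M₀(L)` under the inclusion of `M(L)` is `M₀(L)` as an ideal of `M(L)`. -/
abbrev BogomolovMultiplier : Type _ :=
  ↥(schurKernel Ω L) ⧸ (LieIdeal.comap (schurKernel Ω L).incl (commutingWedges Ω L))

end Exterior

section Cohomology

open LieModule.Cohomology

variable (Ω : Type*) [Field Ω] (L : Type*) [LieRing L] [LieAlgebra Ω L]

/-- 2-coboundaries, as a subspace of the 2-cocycles. -/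
def twoCoboundary (A : Type*) [AddCommGroup A] [Module Ω A] [LieRingModule L A] [LieModule Ω L A] :
    Submodule Ω (twoCocycle Ω L A) :=
  (LinearMap.range (d₁₂ Ω L A)).comap (twoCocycle Ω L A).subtype

/-- `H²(L, A)`. -/
def H2 (A : Type*) [AddCommGroup A] [Module Ω A] [LieRingModule L A] [LieModule Ω L A] : Type _ :=
  twoCocycle Ω L A ⧸ twoCoboundary Ω L A

variable {A : Type*} [AddCommGroup A] [Module Ω A] [LieRingModule L A] [LieModule Ω L A]

instance : AddCommGroup (H2 Ω L A) :=
  inferInstanceAs (AddCommGroup (twoCocycle Ω L A ⧸ twoCoboundary Ω L A))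

instance : Module Ω (H2 Ω L A) :=
  inferInstanceAs (Module Ω (twoCocycle Ω L A ⧸ twoCoboundary Ω L A))

/-- `H²(L, A)` is regarded as an abelian Lie algebra. -/
instance : LieRing (H2 Ω L A) where
  bracket _ _ := 0
  add_lie _ _ _ := (add_zero 0).symm
  lie_add _ _ _ := (add_zero 0).symm
  lie_self _ := rfl
  leibniz_lie _ _ _ := (add_zero 0).symm

instance : LieAlgebra Ω (H2 Ω L A) where
  lie_smul t _ _ := (smul_zero t).symm

variable {L}

/-- The cohomology class of a 2-cocycle. -/
def H2.mk : twoCocycle Ω L A →ₗ[Ω] H2 Ω L A := (twoCoboundary Ω L A).mkQ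

variable (L)

/-- `B₀(L)`: the classes in `H²(L, Ω)`, where `Ω` is the trivial module, of the 2-cocycles `f` such
that `f(x, y) = 0` whenever `[x, y] = 0`. -/
def B0 : LieIdeal Ω (H2 Ω L (TrivialLieModule Ω L Ω)) where
  carrier := {c | ∃ f : twoCocycle Ω L (TrivialLieModule Ω L Ω),
    H2.mk Ω f = c ∧ ∀ x y : L, ⁅x, y⁆ = 0 → f.1 x y = 0}
  add_mem' := by
    rintro _ _ ⟨f, rfl, hf⟩ ⟨g, rfl, hg⟩
    refine ⟨f + g, map_add _ _ _, fun x y h => ?_⟩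
    change f.1 x y + g.1 x y = 0
    rw [hf x y h, hg x y h, add_zero]
  zero_mem' := ⟨0, map_zero _, fun _ _ _ => rfl⟩
  smul_mem' := by
    rintro c _ ⟨f, rfl, hf⟩
    refine ⟨c • f, map_smul _ _ _, fun x y h => ?_⟩
    change c • f.1 x y = 0
    rw [hf x y h, smul_zero]
  lie_mem := fun {_ _} _ => ⟨0, map_zero _, fun _ _ _ => rfl⟩

end Cohomology

end

end BogomolovLie

/-!
The proof is a duality between `L ∧ L` and the 2-cocycles of `L`.

A linear functional `φ` on `L ∧ L` gives the bilinear form `(m, n) ↦ φ (m ∧ n)`, and the relations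
of `L ∧ L` say precisely that this form is a 2-cocycle (`wedgeCocycle`). Every 2-cocycle `f` arises
in this way: on the central extension `L × Ω` of `L` defined by `f`, the commutator of the lifts of
`m` and `n` is `([m, n], f (m, n))`, and `m ∧ n ↦ ([m, n], f (m, n))` respects the relations, so the
second component of the induced homomorphism is the required functional
(`exists_wedgeCocycle_eq`). Under this correspondence, the coboundaries are the functionals
that factor through `L ∧ L → [L, L]`, that is, those that vanish on `M(L)`
(`mk_wedgeCocycle_eq_zero_iff`), and the cocycles vanishing on commuting pairs are the functionals
that vanish on `M₀(L)`.

So the annihilator of `M₀(L)` in the dual of `L ∧ L` maps onto `B₀(L)` (`annihilatorToB0`) and, by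
restriction, onto the dual of `M(L) / M₀(L)` (`annihilatorToDual`), both times with the
functionals vanishing on `M(L)` as the kernel. Hence `B₀(L)` is the dual of `B(L)`. Since `L ∧ L` is
spanned by the `m ∧ n`, it is finite-dimensional along with `L`, and `B(L)` is linearly
isomorphic to its dual. Both Lie algebras are abelian, because `M(L)` is central in `L ∧ L`, so a linear
isomorphism suffices.
-/

namespace BogomolovLie

noncomputable section

open LieModule.Cohomology Module

variable (Ω : Type*) [Field Ω] (L : Type*) [LieRing L] [LieAlgebra Ω L]

/-! ### The exterior square as a vector space -/

/-- The bilinear map `(m, n) ↦ m ∧ n`. -/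
def wedgeBilin : L →ₗ[Ω] L →ₗ[Ω] ExteriorSquare Ω L :=
  LinearMap.mk₂ Ω (wedge Ω)
    (fun m m' n => mk_eq_of_rel Ω (.add_left m m' n))
    (fun c m n => (mk_eq_of_rel Ω (.smul_left c m n)).symm)
    (fun m n n' => mk_eq_of_rel Ω (.add_right m n n'))
    (fun c m n => (mk_eq_of_rel Ω (.smul_right c m n)).symm)

variable {L}

@[simp]
theorem wedgeBilin_apply (m n : L) : wedgeBilin Ω L m n = wedge Ω m n := rfl

@[simp]
theorem wedge_self (m : L) : wedge Ω m m = 0 := mk_eq_of_rel Ω (.self m)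

theorem wedge_lie_left (m m' n : L) :
    wedge Ω ⁅m, m'⁆ n = wedge Ω m ⁅m', n⁆ - wedge Ω m' ⁅m, n⁆ :=
  mk_eq_of_rel Ω (.lie_left m m' n)

theorem lie_wedge_wedge (m n m' n' : L) :
    ⁅wedge Ω m n, wedge Ω m' n'⁆ = -wedge Ω ⁅n, m⁆ ⁅m', n'⁆ :=
  mk_eq_of_rel Ω (.lie_sym m n m' n')

variable (L)

/-- The elements `m ∧ n` generate `L ∧ L` as a Lie algebra, and their brackets are again of this
form up to sign. -/
theorem span_range_wedge :
    Submodule.span Ω (Set.range fun p : L × L => wedge Ω p.1 p.2) = ⊤ := by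
  set V := Submodule.span Ω (Set.range fun p : L × L => wedge Ω p.1 p.2)
  have hlie : ∀ x ∈ V, ∀ y ∈ V, ⁅x, y⁆ ∈ V := by
    intro x hx y hy
    induction hx, hy using Submodule.span_induction₂ with
    | mem_mem x y hx hy =>
      obtain ⟨p, rfl⟩ := hx
      obtain ⟨q, rfl⟩ := hy
      simp only [lie_wedge_wedge]
      exact neg_mem (Submodule.subset_span ⟨(_, _), rfl⟩)
    | zero_left y hy => simp
    | zero_right x hx => simp
    | add_left x y z _ _ _ h₁ h₂ => rw [add_lie]; exact add_mem h₁ h₂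
    | add_right x y z _ _ _ h₁ h₂ => rw [lie_add]; exact add_mem h₁ h₂
    | smul_left r x y _ _ h => rw [smul_lie]; exact V.smul_mem r h
    | smul_right r x y _ _ h => rw [lie_smul]; exact V.smul_mem r h
  let S : LieSubalgebra Ω (FreeLieAlgebra Ω (L × L)) :=
    { V.comap (exteriorIdeal Ω L).toSubmodule.mkQ with
      lie_mem' := fun {a b} ha hb => hlie _ ha _ hb }
  let F : FreeLieAlgebra Ω (L × L) →ₗ⁅Ω⁆ S :=
    FreeLieAlgebra.lift Ω fun p => ⟨FreeLieAlgebra.of Ω p, Submodule.subset_span ⟨p, rfl⟩⟩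
  have hF : S.incl.comp F = LieHom.id := by
    apply FreeLieAlgebra.hom_ext
    intro p
    simp [F]
  refine eq_top_iff.mpr fun w _ => ?_
  induction w using Submodule.Quotient.induction_on with
  | _ w =>
  have hw : ((F w : S) : FreeLieAlgebra Ω (L × L)) = w := LieHom.congr_fun hF w
  have hS := (F w).2
  rw [hw] at hS
  exact hS

variable {Ω L} in
theorem exteriorSquare_hom_ext {A : Type*} [AddCommGroup A] [Module Ω A]
    {φ ψ : ExteriorSquare Ω L →ₗ[Ω] A} (h : ∀ m n, φ (wedge Ω m n) = ψ (wedge Ω m n)) : φ = ψ :=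
  LinearMap.ext_on_range (span_range_wedge Ω L) fun p => h p.1 p.2

instance [FiniteDimensional Ω L] : FiniteDimensional Ω (ExteriorSquare Ω L) := by
  refine Module.Finite.of_surjective (TensorProduct.lift (wedgeBilin Ω L)) ?_
  rw [← LinearMap.range_eq_top, eq_top_iff, ← span_range_wedge, Submodule.span_le]
  rintro _ ⟨p, rfl⟩
  exact ⟨p.1 ⊗ₜ p.2, by simp⟩

/-- The commutator map `L ∧ L → L`, as a linear map into all of `L`. -/
def commutatorLin : ExteriorSquare Ω L →ₗ[Ω] L :=
  (⁅(⊤ : LieIdeal Ω L), (⊤ : LieIdeal Ω L)⁆ : LieIdeal Ω L).toSubmodule.subtype ∘ₗ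
    (commutatorMap Ω L : ExteriorSquare Ω L →ₗ[Ω] _)

@[simp]
theorem commutatorLin_wedge (m n : L) : commutatorLin Ω L (wedge Ω m n) = ⁅m, n⁆ :=
  coe_commutatorMap_wedge Ω m n

theorem mem_schurKernel_iff {w : ExteriorSquare Ω L} :
    w ∈ schurKernel Ω L ↔ commutatorLin Ω L w = 0 :=
  LieHom.mem_ker.trans Subtype.ext_iff

/-- The bracket of `L ∧ L` factors through the commutator map. -/
theorem lie_eq_wedge_commutatorLin (v w : ExteriorSquare Ω L) :
    ⁅v, w⁆ = wedge Ω (commutatorLin Ω L v) (commutatorLin Ω L w) := by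
  have h : LinearMap.mk₂ Ω (fun x y : ExteriorSquare Ω L => ⁅x, y⁆) add_lie smul_lie lie_add
      (fun c x y => lie_smul c x y) =
      (wedgeBilin Ω L).compl₁₂ (commutatorLin Ω L) (commutatorLin Ω L) := by
    refine exteriorSquare_hom_ext fun m n => exteriorSquare_hom_ext fun m' n' => ?_
    simp only [LinearMap.mk₂_apply, lie_wedge_wedge, LinearMap.compl₁₂_apply,
      commutatorLin_wedge]
    rw [← lie_skew m n, map_neg, LinearMap.neg_apply, wedgeBilin_apply]
  exact LinearMap.congr_fun₂ h v w

/-- `M(L)` is central in `L ∧ L`, so the Bogomolov multiplier is abelian. -/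
theorem lie_bogomolovMultiplier (x y : BogomolovMultiplier Ω L) : ⁅x, y⁆ = 0 := by
  induction x using Submodule.Quotient.induction_on with
  | _ x =>
  induction y using Submodule.Quotient.induction_on with
  | _ y =>
  have h : ⁅x, y⁆ = 0 := by
    apply Subtype.ext
    change ⁅(x : ExteriorSquare Ω L), (y : ExteriorSquare Ω L)⁆ = 0
    rw [lie_eq_wedge_commutatorLin, (mem_schurKernel_iff Ω L).mp x.2, ← wedgeBilin_apply,
      map_zero, LinearMap.zero_apply]
  change LieSubmodule.Quotient.mk ⁅x, y⁆ = _
  rw [h]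
  rfl

/-! ### Functionals on the exterior square and 2-cocycles -/

/-- The 2-cocycle `(m, n) ↦ φ (m ∧ n)` attached to a linear functional `φ` on `L ∧ L`. -/
def wedgeCocycle : Dual Ω (ExteriorSquare Ω L) →ₗ[Ω] twoCocycle Ω L (TrivialLieModule Ω L Ω) where
  toFun φ :=
    ⟨⟨(wedgeBilin Ω L).compr₂ ((TrivialLieModule.equiv Ω L Ω).symm.toLinearMap ∘ₗ φ),
      fun x => by simp⟩, by
      rw [mem_twoCocycle_iff_of_trivial]
      intro x y z
      change φ (wedge Ω x ⁅y, z⁆) = φ (wedge Ω ⁅x, y⁆ z) + φ (wedge Ω y ⁅x, z⁆)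
      rw [wedge_lie_left, map_sub, sub_add_cancel]⟩
  map_add' _ _ := rfl
  map_smul' _ _ := rfl

theorem wedgeCocycle_apply (φ : Dual Ω (ExteriorSquare Ω L)) (m n : L) :
    (wedgeCocycle Ω L φ).1 m n = (TrivialLieModule.equiv Ω L Ω).symm (φ (wedge Ω m n)) := rfl

variable {Ω L}

open LieAlgebra in
/-- The bracket of a central extension of `L`. -/
theorem lie_ofProd (f : twoCocycle Ω L (TrivialLieModule Ω L Ω))
    (u v : L × TrivialLieModule Ω L Ω) :
    ⁅ofProd f u, ofProd f v⁆ = ofProd f (⁅u.1, v.1⁆, f.1 u.1 v.1) := by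
  simp [bracket_ofTwoCocycle, trivial_lie_zero]

open LieAlgebra in
/-- Every 2-cocycle comes from a functional on `L ∧ L`, namely the second component of the
homomorphism from `L ∧ L` to the central extension of `L` defined by the cocycle. -/
theorem exists_wedgeCocycle_eq (f : twoCocycle Ω L (TrivialLieModule Ω L Ω)) :
    ∃ φ, wedgeCocycle Ω L φ = f := by
  let F : FreeLieAlgebra Ω (L × L) →ₗ⁅Ω⁆ ofTwoCocycle f :=
    FreeLieAlgebra.lift Ω fun p => ofProd f (⁅p.1, p.2⁆, f.1 p.1 p.2)
  have hFs (m n : L) : F (sym Ω m n) = ofProd f (⁅m, n⁆, f.1 m n) :=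
    FreeLieAlgebra.lift_of_apply _ (m, n)
  let P : ofTwoCocycle f →ₗ⁅Ω⁆ L :=
    { toFun := fun x => ((ofProd f).symm x).1
      map_add' := fun _ _ => rfl
      map_smul' := fun _ _ => rfl
      map_lie' := rfl }
  have hco := (mem_twoCocycle_iff_of_trivial Ω L _ f.1).mp f.2
  have hskew := twoCochain_skew f.1
  have hrel {a b : FreeLieAlgebra Ω (L × L)} (h : ExteriorRel Ω L a b) : F a = F b := by
    -- The first components agree because `commutatorMap` is well defined on `L ∧ L`.
    have hfst : P.comp F = (LieIdeal.incl _).comp (freeCommutator Ω L) := by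
      apply FreeLieAlgebra.hom_ext
      intro p
      exact (congrArg P (hFs p.1 p.2)).trans (coe_freeCommutator_sym Ω p.1 p.2).symm
    have h₁ : P (F a) = P (F b) :=
      (LieHom.congr_fun hfst a).trans ((congrArg Subtype.val (freeCommutator_rel Ω L h)).trans
        (LieHom.congr_fun hfst b).symm)
    refine (ofProd f).symm.injective (Prod.ext h₁ ?_)
    cases h with
    | smul_left α m n => simp [hFs]
    | smul_right α m n => simp [hFs]
    | add_left m m' n => simp [hFs]
    | add_right m n n' => simp [hFs]
    | lie_left m m' n =>
      rw [map_sub, hFs, hFs, hFs]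
      exact eq_sub_of_add_eq (hco m m' n).symm
    | lie_right m n n' =>
      rw [map_sub, hFs, hFs, hFs]
      change f.1 m ⁅n, n'⁆ = f.1 ⁅n', m⁆ n - f.1 ⁅n, m⁆ n'
      rw [hco, ← hskew n, ← lie_skew n' m, ← lie_skew n m, map_neg, map_neg, LinearMap.neg_apply]
      abel
    | lie_sym m n m' n' =>
      rw [LieHom.map_lie, map_neg, hFs, hFs, hFs, lie_ofProd]
      change f.1 ⁅m, n⁆ ⁅m', n'⁆ = -f.1 ⁅n, m⁆ ⁅m', n'⁆
      rw [← lie_skew m n, map_neg, LinearMap.neg_apply]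
    | self m => simp [hFs]
  let φ : ExteriorSquare Ω L →ₗ[Ω] ofTwoCocycle f :=
    Submodule.liftQ (exteriorIdeal Ω L).toSubmodule F.toLinearMap (by
      have : exteriorIdeal Ω L ≤ F.ker := by
        refine LieSubmodule.lieSpan_le.mpr ?_
        rintro x ⟨a, b, h, rfl⟩
        simp [LieHom.mem_ker, map_sub, hrel h]
      exact fun _ hx => LieHom.mem_ker.mp (this hx))
  let snd : ofTwoCocycle f →ₗ[Ω] Ω :=
    { toFun := fun x => TrivialLieModule.equiv Ω L Ω ((ofProd f).symm x).2
      map_add' := fun _ _ => rfl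
      map_smul' := fun _ _ => rfl }
  refine ⟨snd ∘ₗ φ, Subtype.ext (Subtype.ext (LinearMap.ext₂ fun m n => ?_))⟩
  change ((ofProd f).symm (F (sym Ω m n))).2 = f.1 m n
  rw [hFs]
  rfl

variable (Ω L) in
/-- The coboundaries correspond to the functionals vanishing on `M(L)`. -/
theorem mk_wedgeCocycle_eq_zero_iff (φ : Dual Ω (ExteriorSquare Ω L)) :
    H2.mk Ω (wedgeCocycle Ω L φ) = 0 ↔ ∀ w ∈ schurKernel Ω L, φ w = 0 := by
  have h₀ : H2.mk Ω (wedgeCocycle Ω L φ) = 0 ↔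
      ∃ σ, d₁₂ Ω L (TrivialLieModule Ω L Ω) σ = (wedgeCocycle Ω L φ).1 :=
    Submodule.Quotient.mk_eq_zero _
  rw [h₀]
  constructor
  · rintro ⟨σ, hσ⟩ w hw
    have h : φ = -((TrivialLieModule.equiv Ω L Ω).toLinearMap ∘ₗ σ ∘ₗ commutatorLin Ω L) := by
      refine exteriorSquare_hom_ext fun m n => ?_
      have h := congr($hσ m n)
      rw [d₁₂_apply_apply_ofTrivial, wedgeCocycle_apply] at h
      simpa using congr(TrivialLieModule.equiv Ω L Ω $h).symm
    rw [h]
    simp [(mem_schurKernel_iff Ω L).mp hw]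
  · intro h
    have hφ : φ ∈ LinearMap.range (commutatorLin Ω L).dualMap := by
      rw [LinearMap.range_dualMap_eq_dualAnnihilator_ker, Submodule.mem_dualAnnihilator]
      exact fun w hw => h w ((mem_schurKernel_iff Ω L).mpr hw)
    obtain ⟨σ, rfl⟩ := hφ
    refine ⟨-((TrivialLieModule.equiv Ω L Ω).symm.toLinearMap ∘ₗ σ),
      Subtype.ext (LinearMap.ext₂ fun m n => ?_)⟩
    rw [twoCochain_val_apply, twoCochain_val_apply, d₁₂_apply_apply_ofTrivial, wedgeCocycle_apply]
    simp

/-! ### The duality between the Bogomolov multiplier and `B₀(L)` -/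

variable (Ω L)

/-- The map from the annihilator of `M₀(L)` onto `B₀(L)` that sends a functional to the class of
its cocycle. -/
def annihilatorToB0 :
    (commutingWedges Ω L).toSubmodule.dualAnnihilator →ₗ[Ω] B0 Ω L :=
  LinearMap.codRestrict (B0 Ω L).toSubmodule
    (H2.mk Ω ∘ₗ wedgeCocycle Ω L ∘ₗ Submodule.subtype _) fun φ =>
      ⟨wedgeCocycle Ω L φ, rfl, fun x y h => by
        rw [wedgeCocycle_apply, (Submodule.mem_dualAnnihilator _).mp φ.2 _
          (Submodule.subset_span ⟨x, y, h, rfl⟩), map_zero]⟩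

theorem annihilatorToB0_surjective : Function.Surjective (annihilatorToB0 Ω L) := by
  rintro ⟨_, f, rfl, hf⟩
  obtain ⟨φ, rfl⟩ := exists_wedgeCocycle_eq f
  refine ⟨⟨φ, ?_⟩, rfl⟩
  rw [Submodule.mem_dualAnnihilator]
  change commutingWedges Ω L ≤ LinearMap.ker φ
  refine Submodule.span_le.mpr ?_
  rintro _ ⟨m, n, h, rfl⟩
  exact hf m n h

/-- The map from the annihilator of `M₀(L)` onto the dual of `M(L) / M₀(L)` given by restriction
to `M(L)`. -/
def annihilatorToDual :
    (commutingWedges Ω L).toSubmodule.dualAnnihilator →ₗ[Ω] Dual Ω (BogomolovMultiplier Ω L) where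
  toFun φ := Submodule.liftQ _ (φ.1 ∘ₗ (schurKernel Ω L).toSubmodule.subtype) fun _ hw =>
    (Submodule.mem_dualAnnihilator _).mp φ.2 _ hw
  map_add' _ _ := Submodule.linearMap_qext _ rfl
  map_smul' _ _ := Submodule.linearMap_qext _ rfl

theorem annihilatorToDual_surjective : Function.Surjective (annihilatorToDual Ω L) := by
  intro ψ
  obtain ⟨φ, hφ⟩ := LinearMap.exists_extend (p := (schurKernel Ω L).toSubmodule)
    (ψ ∘ₗ Submodule.mkQ _)
  refine ⟨⟨φ, ?_⟩, Submodule.linearMap_qext _ hφ⟩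
  rw [Submodule.mem_dualAnnihilator]
  intro w hw
  have h := LinearMap.congr_fun hφ ⟨w, commutingWedges_le_schurKernel Ω L hw⟩
  refine h.trans ?_
  rw [LinearMap.comp_apply, Submodule.mkQ_apply, (Submodule.Quotient.mk_eq_zero _).mpr, map_zero]
  exact hw

theorem ker_annihilatorToB0 :
    LinearMap.ker (annihilatorToB0 Ω L) = LinearMap.ker (annihilatorToDual Ω L) := by
  ext φ
  have h₁ : annihilatorToB0 Ω L φ = 0 ↔ ∀ w ∈ schurKernel Ω L, φ.1 w = 0 :=
    Subtype.ext_iff.trans (mk_wedgeCocycle_eq_zero_iff Ω L φ.1)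
  rw [LinearMap.mem_ker, LinearMap.mem_ker, h₁]
  constructor
  · exact fun h => Submodule.linearMap_qext _ (LinearMap.ext fun w => h w.1 w.2)
  · exact fun h w hw => LinearMap.congr_fun h (Submodule.Quotient.mk ⟨w, hw⟩)

/-- `B₀(L)` is the dual space of the Bogomolov multiplier. -/
def dualEquivB0 : Dual Ω (BogomolovMultiplier Ω L) ≃ₗ[Ω] B0 Ω L :=
  ((annihilatorToDual Ω L).quotKerEquivOfSurjective (annihilatorToDual_surjective Ω L)).symm ≪≫ₗ
    Submodule.quotEquivOfEq _ _ (ker_annihilatorToB0 Ω L).symm ≪≫ₗ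
    (annihilatorToB0 Ω L).quotKerEquivOfSurjective (annihilatorToB0_surjective Ω L)

end

end BogomolovLie

theorem corollary1p3 (Ω : Type*) [Field Ω] (L : Type*) [LieRing L] [LieAlgebra Ω L]
    [FiniteDimensional Ω L] :
    Nonempty (BogomolovLie.BogomolovMultiplier Ω L ≃ₗ⁅Ω⁆ BogomolovLie.B0 Ω L) := by
  have hfin : FiniteDimensional Ω (BogomolovLie.schurKernel Ω L) :=
    FiniteDimensional.finiteDimensional_submodule (BogomolovLie.schurKernel Ω L).toSubmodule
  have hfin' : FiniteDimensional Ω (BogomolovLie.BogomolovMultiplier Ω L) :=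
    Module.Finite.of_surjective _ (Submodule.mkQ_surjective _)
  -- The identification of a finite-dimensional space with its dual depends on a choice of bases.
  let e : BogomolovLie.BogomolovMultiplier Ω L ≃ₗ[Ω] BogomolovLie.B0 Ω L :=
    (LinearEquiv.ofFinrankEq _ _ Subspace.dual_finrank_eq.symm) ≪≫ₗ BogomolovLie.dualEquivB0 Ω L
  refine ⟨{ e with map_lie' := ?_ }⟩
  intro x y
  rw [BogomolovLie.lie_bogomolovMultiplier]
  exact (map_zero e).trans (Subtype.ext rfl)
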